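/- **Setting.** For $\mu\in\mathbf R$ and $\sigma^2>0$ let $\kappa=\min\{i\in\mathbf Z: i\ge\mu\}$, and let $\Psi(\mu,\sigma^2)$ be the probability distribution on $\mathbf Z$ whose point probabilities $(\pi_j)_{j\in\mathbf Z}$ are $$\pi_j=\Big(\prod_{i=\kappa+1}^{j}\frac{\sigma^2}{\sigma^2+i-\mu}\Big)\pi_\kappa\quad (j\ge\kappa),\qquad \pi_j=\Big(\prod_{i=j}^{\kappa-2}\frac{\sigma^2}{\sigma^2+\mu-i}\Big)\frac{\sigma^2+\kappa-\mu}{\sigma^2+\mu-\kappa+1}\,\pi_\kappa\quad (j\le\kappa-1),$$ where empty products are $1$ and $\pi_\kappa$ is determined by $\sum_{j\in\mathbf Z}\pi_j=1$. Equivalently, $\Psi(\mu,\sigma^2)$ is the unique distribution $\mathcal L(S)$ on $\mathbf Z$ with $\mathbb E\,\mathcal Bf(S)=0$ for all bounded $f:\mathbf Z\to\mathbf R$, where $\mathcal Bf(i)=\sigma^2f(i+1)-(\sigma^2+i-\mu)f(i)$ for $i\ge\kappa$ and $\mathcal Bf(i)=(\sigma^2+\mu-i)f(i+1)-\sigma^2f(i)$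 for $i\le\kappa-1$. For probability measures $\mathbf Q_1,\mathbf Q_2$ on $\mathbf Z$ put $d_{\rm TV}(\mathbf Q_1,\mathbf Q_2)=\sup_{A\subset\mathbf Z}|\mathbf Q_1(A)-\mathbf Q_2(A)|$. **Corollary 4.3.** Let $I_1,\dots,I_n$ be independent indicator random variables with $\mathbb P(I_i=1)=1-\mathbb P(I_i=0)=p_i$, and let $$W=\sum_{i=1}^nI_i,\quad \mu=\sum_{i=1}^np_i,\quad \sigma^2=\sum_{i=1}^np_i(1-p_i),\quad \vartheta^2=\sigma^2-\max_{1\le i\le n}p_i(1-p_i),$$ where $\vartheta>0$. Then $$d_{\rm TV}(\mathcal L(W),\Psi(\mu,\sigma^2))\le\frac1\vartheta .$$ -/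

import Mathlib

open MeasureTheory ProbabilityTheory

noncomputable section

namespace DiscreteNormal

/-- Total variation distance between two probability measures on `ℤ`:
the supremum over all `A ⊆ ℤ` of `|Q₁(A) - Q₂(A)|`. -/
def dTV (Q₁ Q₂ : Measure ℤ) : ℝ :=
  ⨆ A : Set ℤ, |Q₁.real A - Q₂.real A|

/-- The operator `ℬ` with parameters `μ`, `v = σ²` and `κ`, acting on functions `f` on `ℤ`. -/
def steinOp (μ v : ℝ) (κ : ℤ) (f : ℤ → ℝ) (i : ℤ) : ℝ :=
  if κ ≤ i then v * f (i + 1) - (v + i - μ) * f i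
  else (v + μ - i) * f (i + 1) - v * f i

/-- The ratio `π_j / π_κ` of the point probabilities of `Ψ_κ(μ, v)`, where `v = σ²`. An empty
product is `1`, so the value at `j = κ` is `1` and the value at `j = κ - 1` is
`(v + κ - μ) / (v + μ - κ + 1)`. -/
def psiWeight (μ v : ℝ) (κ j : ℤ) : ℝ :=
  if κ ≤ j then ∏ i ∈ Finset.Icc (κ + 1) j, v / (v + i - μ)
  else (∏ i ∈ Finset.Icc j (κ - 2), v / (v + μ - i)) * ((v + κ - μ) / (v + μ - κ + 1))

/-- The distribution `Ψ_κ(μ, v)` on `ℤ`, where `v = σ²`: the point `j` has the probability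
`psiWeight μ v κ j / ∑ₖ psiWeight μ v κ k`. By `eq_psiKappa_iff` below it is the only probability
measure on `ℤ` with `𝔼 ℬf(S) = 0` for all bounded `f`. -/
def psiKappa (μ v : ℝ) (κ : ℤ) : Measure ℤ :=
  Measure.sum fun j : ℤ =>
    ENNReal.ofReal (psiWeight μ v κ j / ∑' k : ℤ, psiWeight μ v κ k) • Measure.dirac j

/-- The distribution `Ψ(μ, v)`, where `v = σ²`: the case `κ = min {i ∈ ℤ : i ≥ μ}`. -/
def psi (μ v : ℝ) : Measure ℤ := psiKappa μ v ⌈μ⌉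

/-! The facts below show that `Ψ_κ(μ, v)` is well defined: the weights are summable, and
`Ψ_κ(μ, v)` is the unique probability measure characterized by `ℬ`. -/

section WellDefined

variable {μ v : ℝ} {κ : ℤ}

/-- The coefficient of `f (i + 1)` in `ℬf(i)`. -/
def birth (μ v : ℝ) (κ i : ℤ) : ℝ := if κ ≤ i then v else v + μ - i

/-- Minus the coefficient of `f i` in `ℬf(i)`. -/
def death (μ v : ℝ) (κ i : ℤ) : ℝ := if κ ≤ i then v + i - μ else v

theorem steinOp_eq (f : ℤ → ℝ) (i : ℤ) :
    steinOp μ v κ f i = birth μ v κ i * f (i + 1) - death μ v κ i * f i := by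
  unfold steinOp birth death
  split_ifs <;> rfl

theorem birth_pos (hv : 0 < v) (h2 : κ < μ + v + 1) (i : ℤ) : 0 < birth μ v κ i := by
  unfold birth
  split_ifs with h
  · exact hv
  · have : (i : ℝ) + 1 ≤ κ := by exact_mod_cast (by omega : i + 1 ≤ κ)
    linarith

theorem death_nonneg (hv : 0 < v) (h1 : μ - v ≤ κ) (i : ℤ) : 0 ≤ death μ v κ i := by
  unfold death
  split_ifs with h
  · have : (κ : ℝ) ≤ i := by exact_mod_cast h
    linarith
  · exact hv.le

theorem death_pos (hv : 0 < v) (h1 : μ - v ≤ κ) {i : ℤ} (hi : i ≠ κ) : 0 < death μ v κ i := by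
  unfold death
  split_ifs with h
  · have : (κ : ℝ) + 1 ≤ i := by exact_mod_cast (by omega : κ + 1 ≤ i)
    linarith
  · exact hv

theorem psiWeight_nonneg (hv : 0 < v) (h1 : μ - v ≤ κ) (h2 : κ < μ + v + 1) (j : ℤ) :
    0 ≤ psiWeight μ v κ j := by
  unfold psiWeight
  split_ifs with h
  · refine Finset.prod_nonneg fun i hi => div_nonneg hv.le ?_
    have : (κ : ℝ) + 1 ≤ i := by exact_mod_cast (Finset.mem_Icc.1 hi).1
    linarith
  · refine mul_nonneg (Finset.prod_nonneg fun i hi => div_nonneg hv.le ?_)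
      (div_nonneg (by linarith) (by linarith))
    have : (i : ℝ) ≤ κ - 2 := by exact_mod_cast (Finset.mem_Icc.1 hi).2
    linarith

theorem psiWeight_self : psiWeight μ v κ κ = 1 := by simp [psiWeight]

/-- The balance equation of the weights. -/
theorem balance (hv : 0 < v) (h1 : μ - v ≤ κ) (h2 : κ < μ + v + 1) (i : ℤ) :
    birth μ v κ i * psiWeight μ v κ i = death μ v κ (i + 1) * psiWeight μ v κ (i + 1) := by
  rcases lt_trichotomy (i + 1) κ with h | h | h
  · have e : Finset.Icc i (κ - 2) = insert i (Finset.Icc (i + 1) (κ - 2)) := by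
      ext x; simp only [Finset.mem_Icc, Finset.mem_insert]; omega
    have hi : (i : ℝ) + 2 ≤ κ := by exact_mod_cast (by omega : i + 2 ≤ κ)
    have hne : v + μ - i ≠ 0 := by linarith
    simp only [birth, death, psiWeight, if_neg (show ¬ κ ≤ i by omega),
      if_neg (show ¬ κ ≤ i + 1 by omega)]
    rw [e, Finset.prod_insert (by simp)]
    field_simp
  · obtain rfl : i = κ - 1 := by omega
    have hne : v + μ - κ + 1 ≠ 0 := by linarith
    simp [birth, death, psiWeight]
    rw [show v + μ - (κ - 1) = v + μ - κ + 1 by ring]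
    field_simp
  · have e : Finset.Icc (κ + 1) (i + 1) = insert (i + 1) (Finset.Icc (κ + 1) i) := by
      ext x; simp only [Finset.mem_Icc, Finset.mem_insert]; omega
    have hi : (κ : ℝ) ≤ i := by exact_mod_cast (by omega : κ ≤ i)
    have hne : v + (i + 1) - μ ≠ 0 := by linarith
    simp only [birth, death, psiWeight, if_pos (show κ ≤ i by omega),
      if_pos (show κ ≤ i + 1 by omega)]
    rw [e, Finset.prod_insert (by simp)]
    push_cast
    field_simp

/-- A sequence which satisfies the balance equation is a multiple of the weights. -/
theorem eq_of_balance (hv : 0 < v) (h1 : μ - v ≤ κ) (h2 : κ < μ + v + 1) {q : ℤ → ℝ}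
    (hq : ∀ i, birth μ v κ i * q i = death μ v κ (i + 1) * q (i + 1)) (j : ℤ) :
    q j = psiWeight μ v κ j * q κ := by
  induction j using Int.inductionOn' (b := κ) with
  | zero => rw [psiWeight_self, one_mul]
  | succ k hk ih =>
    have hd := death_pos hv h1 (show k + 1 ≠ κ by omega)
    have e1 := hq k
    have e2 := balance hv h1 h2 k
    rw [ih] at e1
    apply mul_left_cancel₀ hd.ne'
    rw [← e1, ← mul_assoc, ← mul_assoc, e2]
  | pred k hk ih =>
    have hb := birth_pos hv h2 (k - 1)
    have e1 := hq (k - 1)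
    have e2 := balance hv h1 h2 (k - 1)
    rw [sub_add_cancel] at e1 e2
    apply mul_left_cancel₀ hb.ne'
    rw [e1, ih, ← mul_assoc, ← mul_assoc, e2]

theorem summable_psiWeight (hv : 0 < v) (h1 : μ - v ≤ κ) (h2 : κ < μ + v + 1) :
    Summable (psiWeight μ v κ) := by
  have hw := psiWeight_nonneg hv h1 h2
  rw [← (Equiv.addRight κ).summable_iff]
  obtain ⟨N, hN⟩ := exists_nat_ge (2 * v + |μ - κ|)
  have ha := abs_le.1 (le_refl |μ - κ|)
  apply Summable.of_nat_of_neg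
  · refine summable_of_ratio_norm_eventually_le (r := 1 / 2) (by norm_num) ?_
    filter_upwards [Filter.eventually_ge_atTop N] with n hn
    have hn' : (N : ℝ) ≤ n := by exact_mod_cast hn
    have e := balance hv h1 h2 ((n : ℤ) + κ)
    simp only [birth, death, if_pos (show κ ≤ (n : ℤ) + κ by omega),
      if_pos (show κ ≤ (n : ℤ) + κ + 1 by omega)] at e
    simp only [Function.comp, Equiv.coe_addRight, Real.norm_of_nonneg (hw _)]
    push_cast at e ⊢
    rw [show (n : ℤ) + 1 + κ = n + κ + 1 by ring]
    have h3 := hw (n + κ + 1)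
    have : 2 * v ≤ v + (n + κ + 1) - μ := by linarith [ha.2, le_abs_self (μ - κ)]
    nlinarith [mul_le_mul_of_nonneg_right this h3]
  · refine summable_of_ratio_norm_eventually_le (r := 1 / 2) (by norm_num) ?_
    filter_upwards [Filter.eventually_ge_atTop (N + 1)] with n hn
    have hn' : (N : ℝ) + 1 ≤ n := by exact_mod_cast hn
    have e := balance hv h1 h2 (-(n : ℤ) + κ - 1)
    simp only [birth, death, if_neg (show ¬ κ ≤ -(n : ℤ) + κ - 1 by omega),
      sub_add_cancel, if_neg (show ¬ κ ≤ -(n : ℤ) + κ by omega)] at e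
    simp only [Function.comp, Equiv.coe_addRight, Real.norm_of_nonneg (hw _)]
    push_cast at e ⊢
    rw [show -((n : ℤ) + 1) + κ = -n + κ - 1 by ring]
    have h3 := hw (-n + κ - 1)
    have : 2 * v ≤ v + μ - (-n + κ - 1) := by linarith [neg_abs_le (μ - κ)]
    nlinarith [mul_le_mul_of_nonneg_right this h3]

theorem tsum_psiWeight_pos (hv : 0 < v) (h1 : μ - v ≤ κ) (h2 : κ < μ + v + 1) :
    0 < ∑' k : ℤ, psiWeight μ v κ k :=
  (summable_psiWeight hv h1 h2).tsum_pos (psiWeight_nonneg hv h1 h2) κ (by simp [psiWeight_self])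

theorem psiKappa_singleton (hv : 0 < v) (h1 : μ - v ≤ κ) (h2 : κ < μ + v + 1) (j : ℤ) :
    (psiKappa μ v κ).real {j} = psiWeight μ v κ j / ∑' k : ℤ, psiWeight μ v κ k := by
  rw [measureReal_def, psiKappa, Measure.sum_smul_dirac_singleton, ENNReal.toReal_ofReal]
  exact div_nonneg (psiWeight_nonneg hv h1 h2 j) (tsum_psiWeight_pos hv h1 h2).le

theorem isProbabilityMeasure_psiKappa (hv : 0 < v) (h1 : μ - v ≤ κ) (h2 : κ < μ + v + 1) :
    IsProbabilityMeasure (psiKappa μ v κ) := by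
  refine ⟨?_⟩
  have hs := tsum_psiWeight_pos hv h1 h2
  simp only [psiKappa, Measure.sum_apply _ MeasurableSet.univ, Measure.smul_apply,
    measure_univ, smul_eq_mul, mul_one]
  rw [← ENNReal.ofReal_tsum_of_nonneg
    (fun j => div_nonneg (psiWeight_nonneg hv h1 h2 j) hs.le)
    ((summable_psiWeight hv h1 h2).div_const _), tsum_div_const, div_self hs.ne',
    ENNReal.ofReal_one]

theorem summable_birth_mul (hv : 0 < v) (h1 : μ - v ≤ κ) (h2 : κ < μ + v + 1) :
    Summable fun i => birth μ v κ i * psiWeight μ v κ i := by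
  have hw := psiWeight_nonneg hv h1 h2
  have hsum := summable_psiWeight hv h1 h2
  have hshift : Summable fun i : ℤ => psiWeight μ v κ (i + 1) := by
    have := (Equiv.addRight (1 : ℤ)).summable_iff.2 hsum
    exact this
  set c : ℝ := birth μ v κ (κ - 1) * psiWeight μ v κ (κ - 1) with hc
  have hfin : Summable fun i : ℤ => if i = κ - 1 then c else 0 :=
    summable_of_ne_finset_zero (s := {κ - 1}) fun i hi => if_neg (by simpa using hi)
  have hbound : Summable fun i : ℤ => v * psiWeight μ v κ i + v * psiWeight μ v κ (i + 1)
      + if i = κ - 1 then c else 0 :=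
    ((hsum.mul_left v).add (hshift.mul_left v)).add hfin
  refine Summable.of_nonneg_of_le (fun i => mul_nonneg (birth_pos hv h2 i).le (hw i)) ?_ hbound
  intro i
  have p1 : 0 ≤ v * psiWeight μ v κ i := mul_nonneg hv.le (hw i)
  have p2 : 0 ≤ v * psiWeight μ v κ (i + 1) := mul_nonneg hv.le (hw (i + 1))
  rcases lt_trichotomy (i + 1) κ with h | h | h
  · have e : death μ v κ (i + 1) = v := if_neg (by omega)
    rw [balance hv h1 h2 i, e, if_neg (by omega)]
    linarith
  · have hi : i = κ - 1 := by omega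
    rw [if_pos hi, hc, ← hi]
    linarith
  · have e : birth μ v κ i = v := if_pos (by omega)
    rw [e, if_neg (by omega)]
    linarith

/-- `Ψ_κ(μ, v)` is the unique distribution with `𝔼 ℬf(S) = 0` for all bounded `f`. -/
theorem eq_psiKappa_iff (hv : 0 < v) (h1 : μ - v ≤ κ) (h2 : κ < μ + v + 1)
    (ν : Measure ℤ) [IsProbabilityMeasure ν] :
    ν = psiKappa μ v κ ↔ ∀ f : ℤ → ℝ, (∃ C, ∀ i, |f i| ≤ C) →
      Integrable (steinOp μ v κ f) ν ∧ ∫ i, steinOp μ v κ f i ∂ν = 0 := by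
  have hw := psiWeight_nonneg hv h1 h2
  have hsum := summable_psiWeight hv h1 h2
  have hs := tsum_psiWeight_pos hv h1 h2
  constructor
  · rintro rfl f ⟨C, hC⟩
    have hC0 : 0 ≤ C := (abs_nonneg _).trans (hC 0)
    have hsing := psiKappa_singleton hv h1 h2
    have hbw := summable_birth_mul hv h1 h2
    have hA : Summable fun i => birth μ v κ i * psiWeight μ v κ i * f (i + 1) := by
      refine Summable.of_norm_bounded (hbw.mul_right C) fun i => ?_
      rw [norm_mul, Real.norm_of_nonneg (mul_nonneg (birth_pos hv h2 i).le (hw i))]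
      exact mul_le_mul_of_nonneg_left (hC _) (mul_nonneg (birth_pos hv h2 i).le (hw i))
    have hshiftfun : (fun i => birth μ v κ i * psiWeight μ v κ i * f (i + 1)) =
        (fun i => death μ v κ i * psiWeight μ v κ i * f i) ∘ Equiv.addRight (1 : ℤ) := by
      funext i
      simp [balance hv h1 h2]
    have hB : Summable fun i => death μ v κ i * psiWeight μ v κ i * f i := by
      rw [← (Equiv.addRight (1 : ℤ)).summable_iff, ← hshiftfun]
      exact hA
    have hint : Integrable (steinOp μ v κ f) (psiKappa μ v κ) := by
      rw [psiKappa, integrable_sum_dirac_iff (by simp)]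
      have := ((hA.sub hB).norm.div_const (∑' k : ℤ, psiWeight μ v κ k))
      refine this.congr fun i => ?_
      rw [ENNReal.toReal_ofReal (div_nonneg (hw i) hs.le), steinOp_eq,
        show birth μ v κ i * psiWeight μ v κ i * f (i + 1)
          - death μ v κ i * psiWeight μ v κ i * f i
          = psiWeight μ v κ i * (birth μ v κ i * f (i + 1) - death μ v κ i * f i) by ring,
        norm_mul, Real.norm_of_nonneg (hw i)]
      ring
    refine ⟨hint, ?_⟩
    rw [integral_countable hint]
    have : ∀ i, (psiKappa μ v κ).real {i} • steinOp μ v κ f i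
        = (birth μ v κ i * psiWeight μ v κ i * f (i + 1)
          - death μ v κ i * psiWeight μ v κ i * f i) / ∑' k : ℤ, psiWeight μ v κ k := by
      intro i
      rw [hsing, steinOp_eq, smul_eq_mul]
      ring
    simp_rw [this]
    rw [tsum_div_const, hA.tsum_sub hB, hshiftfun]
    have := (Equiv.addRight (1 : ℤ)).tsum_eq
      (fun i => death μ v κ i * psiWeight μ v κ i * f i)
    simp only [Function.comp_def]
    rw [this, sub_self, zero_div]
  · intro H
    have hq : ∀ i, birth μ v κ i * ν.real {i} = death μ v κ (i + 1) * ν.real {i + 1} := by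
      intro i
      obtain ⟨hI, h0⟩ := H (fun k => if k = i + 1 then 1 else 0)
        ⟨1, fun k => by split_ifs <;> simp⟩
      rw [integral_countable hI] at h0
      rw [tsum_eq_sum (s := {i, i + 1})] at h0
      · rw [Finset.sum_pair (by omega)] at h0
        simp [steinOp_eq] at h0
        linarith
      · intro b hb
        simp only [Finset.mem_insert, Finset.mem_singleton, not_or] at hb
        simp [steinOp_eq, hb.1, hb.2]
    have hq' := eq_of_balance hv h1 h2 hq
    have hone : (∑' k : ℤ, psiWeight μ v κ k) * ν.real {κ} = 1 := by
      have := integral_countable (integrable_const (μ := ν) (1 : ℝ))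
      simp only [integral_const, probReal_univ, smul_eq_mul, mul_one] at this
      rw [← tsum_mul_right, this]
      exact tsum_congr fun k => (hq' k).symm
    have := isProbabilityMeasure_psiKappa hv h1 h2
    refine Measure.ext_of_singleton fun j => ?_
    rw [← ENNReal.toReal_eq_toReal_iff' (measure_ne_top _ _) (measure_ne_top _ _)]
    have e := psiKappa_singleton hv h1 h2 j
    rw [measureReal_def] at e
    have e2 := hq' j
    rw [measureReal_def] at e2
    rw [e, e2, eq_div_iff hs.ne', mul_assoc, mul_comm (ν.real {κ}), hone, mul_one]

end WellDefined

end DiscreteNormal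

end

namespace DiscreteNormal

/-! The proof is Stein's method. For a set A let f solve ℬf = 1_A − Ψ(A), so that the difference of
the two probabilities of A is E ℬf(W). By `exists_stein_solution` the increments D = Δf satisfy |D|
≤ 1/σ².

Since κ = ⌈μ⌉, the two branches of ℬ merge (`steinOp_eq_symm`) into ℬf(k) = σ² D(k) − (k − μ)(f(k) +
f(k+1))/2 + |k − μ| D(k)/2. Write W_i for W without I_i. The identity E (W − μ)g(W) = ∑ p_i(1 − p_i)
E Δg(W_i) (`successExp_centered`) turns the first two terms into ∑ p_i(1 − p_i)(p_i − 1/2) E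
ΔD(W_i). Taking g to be a sign function, it also controls E|W − μ| in the third.

Both contributions are small because W_i is spread out: if M bounds all point probabilities of all
W_i, then |E ΔD(W_i)| ≤ 2M/σ² by unimodality (`abs_successExp_diff_le`) and E|W − μ| ≤ 2σ²M. Each
contribution is then at most M. Finally Var W_i ≥ ϑ², and a Fourier estimate (`successProb_le`)
gives M = 1/(2ϑ), so 2M = 1/ϑ. -/

/-- The expectation of `g` under the law of the number of successes in independent trials
indexed by `S` with success probabilities `p`. -/
noncomputable def successExp {ι : Type*} [DecidableEq ι] (p : ι → ℝ) (S : Finset ι) (g : ℤ → ℝ) :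
    ℝ :=
  ∑ T ∈ S.powerset, (∏ i ∈ T, p i) * (∏ i ∈ S \ T, (1 - p i)) * g T.card

/-! ### Expectations of functions of the number of successes -/

section SuccessExp

variable {ι : Type*} [DecidableEq ι] {p : ι → ℝ} {S : Finset ι}

theorem successExp_empty (g : ℤ → ℝ) : successExp p ∅ g = g 0 := by
  simp [successExp]

/-- Conditioning on trial `i`: the subsets of `insert i S` split by whether they contain `i`. This
recursion drives the inductions below. -/
theorem successExp_insert {i : ι} (hi : i ∉ S) (g : ℤ → ℝ) :
    successExp p (insert i S) g
      = (1 - p i) * successExp p S g + p i * successExp p S fun k => g (k + 1) := by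
  unfold successExp
  rw [Finset.sum_powerset_insert hi, Finset.mul_sum, Finset.mul_sum]
  congr 1
  · refine Finset.sum_congr rfl fun T hT => ?_
    have hiT : i ∉ T := fun h => hi (Finset.mem_powerset.1 hT h)
    rw [Finset.insert_sdiff_of_notMem _ hiT, Finset.prod_insert (by simp [hi])]
    ring
  · refine Finset.sum_congr rfl fun T hT => ?_
    have hiT : i ∉ T := fun h => hi (Finset.mem_powerset.1 hT h)
    have e : insert i S \ insert i T = S \ T := by
      ext x
      simp only [Finset.mem_sdiff, Finset.mem_insert]
      constructor
      · tauto
      · rintro ⟨h1, h2⟩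
        exact ⟨Or.inr h1, by rintro (rfl | h); exacts [hi h1, h2 h]⟩
    rw [e, Finset.prod_insert hiT, Finset.card_insert_of_notMem hiT]
    push_cast
    ring

theorem successExp_add (g h : ℤ → ℝ) :
    successExp p S (fun k => g k + h k) = successExp p S g + successExp p S h := by
  simp only [successExp, mul_add, Finset.sum_add_distrib]

theorem successExp_sub (g h : ℤ → ℝ) :
    successExp p S (fun k => g k - h k) = successExp p S g - successExp p S h := by
  simp only [successExp, mul_sub, Finset.sum_sub_distrib]

theorem successExp_const_mul (a : ℝ) (g : ℤ → ℝ) :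
    successExp p S (fun k => a * g k) = a * successExp p S g := by
  simp only [successExp, Finset.mul_sum]
  exact Finset.sum_congr rfl fun T _ => by ring

theorem successExp_const (a : ℝ) : successExp p S (fun _ => a) = a := by
  induction S using Finset.induction_on with
  | empty => rw [successExp_empty]
  | insert i S hi ih => rw [successExp_insert hi, ih]; ring

theorem successExp_mono (h0 : ∀ i, 0 ≤ p i) (h1 : ∀ i, p i ≤ 1) {g h : ℤ → ℝ}
    (hgh : ∀ k, g k ≤ h k) : successExp p S g ≤ successExp p S h :=
  Finset.sum_le_sum fun _ _ => mul_le_mul_of_nonneg_left (hgh _)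
    (mul_nonneg (Finset.prod_nonneg fun i _ => h0 i)
      (Finset.prod_nonneg fun i _ => sub_nonneg.2 (h1 i)))

theorem abs_successExp_le (h0 : ∀ i, 0 ≤ p i) (h1 : ∀ i, p i ≤ 1) {g h : ℤ → ℝ}
    (hgh : ∀ k, |g k| ≤ h k) : |successExp p S g| ≤ successExp p S h := by
  refine abs_le.2 ⟨?_, successExp_mono h0 h1 fun k => (le_abs_self _).trans (hgh k)⟩
  have := successExp_mono (S := S) h0 h1 fun k =>
    show -1 * h k ≤ g k by linarith [neg_abs_le (g k), hgh k]
  rw [successExp_const_mul] at this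
  linarith

/-- The first order identity for sums of independent indicators. -/
theorem successExp_centered (f : ℤ → ℝ) :
    successExp p S (fun k => (k - ∑ i ∈ S, p i) * f k)
      = ∑ i ∈ S, p i * (1 - p i) * successExp p (S.erase i) fun k => f (k + 1) - f k := by
  induction S using Finset.induction_on generalizing f with
  | empty => simp [successExp_empty]
  | insert j S hj ih =>
    have e1 := ih f
    have e2 := ih fun k => f (k + 1)
    have e3 : ∀ i ∈ S, successExp p ((insert j S).erase i) (fun k => f (k + 1) - f k)
        = (1 - p j) * successExp p (S.erase i) (fun k => f (k + 1) - f k)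
          + p j * successExp p (S.erase i) (fun k => f (k + 1 + 1) - f (k + 1)) := by
      intro i hi
      have hne : j ≠ i := fun h => hj (h ▸ hi)
      rw [Finset.erase_insert_of_ne hne, successExp_insert (by simp [hj])]
    have s3 : ∀ a b : ι → ℝ, ∑ i ∈ S, p i * (1 - p i) * ((1 - p j) * a i + p j * b i)
        = (1 - p j) * ∑ i ∈ S, p i * (1 - p i) * a i
          + p j * ∑ i ∈ S, p i * (1 - p i) * b i := by
      intro a b
      rw [Finset.mul_sum, Finset.mul_sum, ← Finset.sum_add_distrib]
      exact Finset.sum_congr rfl fun i _ => by ring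
    rw [Finset.sum_insert hj, Finset.sum_insert hj, Finset.erase_insert hj,
      Finset.sum_congr rfl fun i hi => congrArg (p i * (1 - p i) * ·) (e3 i hi), s3,
      successExp_insert hj]
    -- The summand of the new index `j`: failure leaves −p_j f(k) with weight 1 − p_j, success
    -- leaves (1 − p_j) f(k+1) with weight p_j, and together they give p_j(1 − p_j)(f(k+1) − f(k)).
    have s1 : (fun k : ℤ => ((k : ℝ) - (p j + ∑ i ∈ S, p i)) * f k)
        = fun k : ℤ => ((k : ℝ) - ∑ i ∈ S, p i) * f k - p j * f k := by
      funext k; ring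
    have s2 : (fun k : ℤ => (((k + 1 : ℤ) : ℝ) - (p j + ∑ i ∈ S, p i)) * f (k + 1))
        = fun k : ℤ => ((k : ℝ) - ∑ i ∈ S, p i) * f (k + 1) + (1 - p j) * f (k + 1) := by
      funext k; push_cast; ring
    rw [s1, s2, successExp_sub, successExp_add, successExp_const_mul, successExp_const_mul, e1, e2,
      successExp_sub]
    ring

/-! ### Log-concavity and smoothing -/

/-- The point probabilities of the number of successes. -/
noncomputable def successProb (p : ι → ℝ) (S : Finset ι) (k : ℤ) : ℝ :=
  successExp p S fun j => if j = k then 1 else 0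

theorem successProb_insert {i : ι} (hi : i ∉ S) (k : ℤ) :
    successProb p (insert i S) k
      = (1 - p i) * successProb p S k + p i * successProb p S (k - 1) := by
  simp only [successProb, successExp_insert hi, eq_sub_iff_add_eq]

theorem successProb_empty (k : ℤ) : successProb p ∅ k = if 0 = k then 1 else 0 := by
  rw [successProb, successExp_empty]

theorem successProb_nonneg (h0 : ∀ i, 0 ≤ p i) (h1 : ∀ i, p i ≤ 1) (k : ℤ) :
    0 ≤ successProb p S k := by
  rw [← successExp_const (p := p) (S := S) 0]
  exact successExp_mono h0 h1 fun j => by split_ifs <;> norm_num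

/-- Any window `K` containing the support of the count shifted by `a` is allowed, so that sums for
different shifts can be written over one common `K` and subtracted. -/
theorem successExp_eq_sum {K : Finset ℤ} {a : ℤ} (hK : Finset.Icc a (a + S.card) ⊆ K)
    (g : ℤ → ℝ) :
    successExp p S (fun j => g (j + a)) = ∑ k ∈ K, g k * successProb p S (k - a) := by
  simp only [successProb, ← successExp_const_mul]
  unfold successExp
  rw [Finset.sum_comm]
  refine Finset.sum_congr rfl fun T hT => ?_
  have hc : (T.card : ℤ) ≤ S.card := by
    exact_mod_cast Finset.card_le_card (Finset.mem_powerset.1 hT)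
  rw [← Finset.mul_sum, Finset.sum_eq_single (T.card + a : ℤ)]
  · simp
  · intro b _ hb
    dsimp only
    rw [if_neg (by omega), mul_zero]
  · intro h
    exact absurd (hK (Finset.mem_Icc.2 ⟨by omega, by omega⟩)) h

/-- The point probabilities form a log-concave sequence without internal zeros. -/
theorem successProb_logConcave (h0 : ∀ i, 0 ≤ p i) (h1 : ∀ i, p i ≤ 1) {i j : ℤ} (hij : i ≤ j) :
    successProb p S (i - 1) * successProb p S (j + 1)
      ≤ successProb p S i * successProb p S j := by
  induction S using Finset.induction_on generalizing i j with
  | empty =>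
    simp only [successProb_empty]
    split_ifs <;> first | omega | norm_num
  | insert a S ha ih =>
    simp only [successProb_insert ha]
    have hp := h0 a
    have hq : 0 ≤ 1 - p a := sub_nonneg.2 (h1 a)
    have A := ih hij
    have B := ih (show i - 1 ≤ j - 1 by omega)
    -- After expansion `A` handles the squared failure weight, `B` the squared success weight and
    -- `C` the mixed weight, where the product of the terms at i − 1 and j is common to both sides.
    -- `C` moves the indices inward twice; for i = j the first move already suffices.
    have C : successProb p S (i - 1 - 1) * successProb p S (j + 1)
        ≤ successProb p S i * successProb p S (j - 1) := by
      have C1 := ih (show i - 1 ≤ j by omega)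
      rcases hij.lt_or_eq with h | rfl
      · have C2 := ih (show i ≤ j - 1 by omega)
        rw [sub_add_cancel] at C2
        exact C1.trans C2
      · linarith
    rw [sub_add_cancel] at B
    rw [add_sub_cancel_right]
    nlinarith [mul_le_mul_of_nonneg_left A (mul_nonneg hq hq),
      mul_le_mul_of_nonneg_left B (mul_nonneg hp hp),
      mul_le_mul_of_nonneg_left C (mul_nonneg hp hq)]

/-- The smoothing inequality: the total variation of the point probabilities is at most twice
their maximum. -/
theorem abs_successExp_diff_le (h0 : ∀ i, 0 ≤ p i) (h1 : ∀ i, p i ≤ 1) {g : ℤ → ℝ} {B M : ℝ}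
    (hg : ∀ k, |g k| ≤ B) (hM : ∀ k, successProb p S k ≤ M) :
    |successExp p S fun k => g (k + 1) - g k| ≤ 2 * B * M := by
  have hB : 0 ≤ B := (abs_nonneg _).trans (hg 0)
  set c := successProb p S with hc
  have hc0 : ∀ k, 0 ≤ c k := successProb_nonneg h0 h1
  set K := Finset.Icc (0 : ℤ) (S.card + 1) with hK
  -- Summation by parts; `K` extends to `S.card + 1` to hold the law shifted by one.
  have hsum : ∀ f : ℤ → ℝ, (successExp p S fun k => f (k + 1) - f k)
      = ∑ k ∈ K, f k * (c (k - 1) - c k) := by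
    intro f
    have a0 := successExp_eq_sum (p := p) (S := S) (K := K) (a := 0)
      (Finset.Icc_subset_Icc (by omega) (by omega)) f
    have a1 := successExp_eq_sum (p := p) (S := S) (K := K) (a := 1)
      (Finset.Icc_subset_Icc (by omega) (by omega)) f
    simp only [add_zero, sub_zero] at a0
    rw [successExp_sub, a0, a1, ← Finset.sum_sub_distrib]
    exact Finset.sum_congr rfl fun k _ => by ring
  -- A mode `m`. Log-concavity gives c(k−1)c(m) ≤ c(k)c(m−1) ≤ c(k)c(m) for k < m; cancelling c(m)
  -- shows that c increases up to `m`, and symmetrically decreases afterwards.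
  obtain ⟨m, hmK, hm⟩ := Finset.exists_max_image K c
    ⟨0, Finset.mem_Icc.2 ⟨le_rfl, by positivity⟩⟩
  have hout : ∀ k, k ∉ K → c k = 0 := by
    intro k hk
    have hk' : ¬ (0 ≤ k ∧ k ≤ S.card + 1) := fun h => hk (Finset.mem_Icc.2 h)
    rw [hc]
    refine Finset.sum_eq_zero fun T hT => ?_
    have := Finset.card_le_card (Finset.mem_powerset.1 hT)
    dsimp only
    rw [if_neg (by omega), mul_zero]
  have hmax : ∀ k, c k ≤ c m := by
    intro k
    by_cases hk : k ∈ K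
    · exact hm k hk
    · rw [hout k hk]; exact hc0 m
  have hmono : ∀ k, k ≤ m → c (k - 1) ≤ c k := by
    intro k hk
    rcases hk.lt_or_eq with h | rfl
    · rcases (hc0 m).lt_or_eq with hpos | hz
      · have := successProb_logConcave (S := S) h0 h1 (show k ≤ m - 1 by omega)
        rw [sub_add_cancel] at this
        refine le_of_mul_le_mul_right (this.trans ?_) hpos
        exact mul_le_mul_of_nonneg_left (hmax _) (hc0 _)
      · linarith [hmax (k - 1), hc0 k]
    · exact hmax _
  have hanti : ∀ k, m < k → c k ≤ c (k - 1) := by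
    intro k hk
    rcases (show m + 1 ≤ k by omega).lt_or_eq with h | rfl
    · rcases (hc0 m).lt_or_eq with hpos | hz
      · have := successProb_logConcave (S := S) h0 h1 (show m + 1 ≤ k - 1 by omega)
        rw [sub_add_cancel, add_sub_cancel_right] at this
        refine le_of_mul_le_mul_left (this.trans ?_) hpos
        exact mul_le_mul_of_nonneg_right (hmax _) (hc0 _)
      · linarith [hmax k, hc0 (k - 1)]
    · rw [add_sub_cancel_right]; exact hmax _
  -- The total variation of c is read off from the same identity: a sign function switching at `m`
  -- has the single increment −2, located at `m`, so the variation is 2c(m).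
  have hsign := hsum fun k => if k ≤ m then 1 else -1
  have hstep : (fun k : ℤ => (if k + 1 ≤ m then (1 : ℝ) else -1) - if k ≤ m then 1 else -1)
      = fun k => -2 * if k = m then 1 else 0 := by
    funext k
    split_ifs <;> first | omega | norm_num
  rw [hstep, successExp_const_mul] at hsign
  rw [hsum]
  calc |∑ k ∈ K, g k * (c (k - 1) - c k)|
      ≤ ∑ k ∈ K, B * -((if k ≤ m then 1 else -1) * (c (k - 1) - c k)) := by
        refine (Finset.abs_sum_le_sum_abs _ _).trans (Finset.sum_le_sum fun k _ => ?_)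
        rw [abs_mul]
        refine mul_le_mul (hg k) ?_ (abs_nonneg _) hB
        split_ifs with h
        · rw [abs_of_nonpos (by linarith [hmono k h])]; linarith
        · rw [abs_of_nonneg (by linarith [hanti k (by omega)])]; linarith
    _ = 2 * B * c m := by
        rw [← Finset.mul_sum, Finset.sum_neg_distrib, ← hsign]
        change B * -(-2 * c m) = _
        ring
    _ ≤ 2 * B * M := mul_le_mul_of_nonneg_left (hM m) (by positivity)

end SuccessExp

/-! ### A Bessel-type integral -/

/-- The mean of `sin ^ (2 n)`, that is, `(2n choose n) / 4 ^ n`. -/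
noncomputable def wallisMean (n : ℕ) : ℝ := ∏ i ∈ Finset.range n, (2 * (i : ℝ) + 1) / (2 * i + 2)

theorem wallisMean_sq_le (n : ℕ) : wallisMean (n + 1) ^ 2 ≤ 1 / (2 * ((n : ℝ) + 2)) := by
  induction n with
  | zero => norm_num [wallisMean]
  | succ n ih =>
    have e : wallisMean (n + 1 + 1)
        = wallisMean (n + 1) * ((2 * ((n + 1 : ℕ) : ℝ) + 1) / (2 * ((n + 1 : ℕ) : ℝ) + 2)) :=
      Finset.prod_range_succ _ _
    rw [e, mul_pow]
    refine (mul_le_mul_of_nonneg_right ih (sq_nonneg _)).trans ?_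
    have hn : (0 : ℝ) ≤ n := n.cast_nonneg
    push_cast
    rw [div_pow, div_mul_div_comm, div_le_div_iff₀ (by positivity) (by positivity)]
    nlinarith [pow_nonneg hn 2, pow_nonneg hn 3]

/-- Since c ≤ rc²/2 + 1/(2r), the square-root decay of the means is replaced by terms whose
exponential generating series are explicit; the tangency point n + 1 = r²/2 matches the dominant
terms of that series. The last summand makes n = 0 an equality. -/
theorem wallisMean_le {r : ℝ} (hr : 0 < r) (n : ℕ) :
    wallisMean n ≤ r / 4 * (1 / (n + 1)) + 1 / (2 * r)
      + if n = 0 then 1 - r / 4 - 1 / (2 * r) else 0 := by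
  rcases n with _ | n
  · norm_num [wallisMean]
  · have h := wallisMean_sq_le n
    set c := wallisMean (n + 1)
    rw [if_neg (by omega), add_zero]
    have h2 : c ≤ r / 2 * c ^ 2 + 1 / (2 * r) := by
      have : r / 2 * c ^ 2 + 1 / (2 * r) - c = (r * c - 1) ^ 2 / (2 * r) := by
        field_simp; ring
      have : 0 ≤ (r * c - 1) ^ 2 / (2 * r) := by positivity
      linarith
    have h3 : r / 2 * c ^ 2 ≤ r / 2 * (1 / (2 * ((n : ℝ) + 2))) :=
      mul_le_mul_of_nonneg_left h (by positivity)
    have h4 : r / 2 * (1 / (2 * ((n : ℝ) + 2))) = r / 4 * (1 / (((n + 1 : ℕ) : ℝ) + 1)) := by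
      push_cast
      field_simp
      ring
    linarith

theorem hasSum_integral_exp_mul_sin_sq {a : ℝ} (ha : 0 ≤ a) :
    HasSum (fun n : ℕ => a ^ n / n.factorial * (Real.pi * wallisMean n))
      (∫ u in (0 : ℝ)..Real.pi, Real.exp (a * Real.sin u ^ 2)) := by
  have h := intervalIntegral.hasSum_integral_of_dominated_convergence
    (μ := volume) (a := 0) (b := Real.pi)
    (F := fun (n : ℕ) (u : ℝ) => a ^ n / n.factorial * Real.sin u ^ (2 * n))
    (f := fun u => Real.exp (a * Real.sin u ^ 2))
    (fun n _ => a ^ n / n.factorial)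
    (fun n => by
      apply Continuous.aestronglyMeasurable
      fun_prop)
    (fun n => Filter.Eventually.of_forall fun u _ => by
      rw [norm_mul, Real.norm_of_nonneg (by positivity), pow_mul, norm_pow,
        Real.norm_of_nonneg (sq_nonneg _)]
      exact mul_le_of_le_one_right (by positivity) (pow_le_one₀ (sq_nonneg _) (Real.sin_sq_le_one u)))
    (Filter.Eventually.of_forall fun u _ => Real.summable_pow_div_factorial a)
    (by simp)
    (Filter.Eventually.of_forall fun u _ => by
      have := NormedSpace.expSeries_div_hasSum_exp (a * Real.sin u ^ 2)
      rw [← Real.exp_eq_exp_ℝ] at this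
      refine this.congr_fun fun n => ?_
      rw [mul_pow, pow_mul]
      ring)
  refine h.congr_fun fun n => ?_
  rw [intervalIntegral.integral_const_mul, integral_sin_pow_even]
  rfl

/-- Summing `wallisMean_le` against aⁿ/n! gives exactly e^a/r − (r − 2)²/(4r), up to the factor π.
-/
theorem integral_exp_mul_sin_sq_le {r : ℝ} (hr : 0 < r) :
    ∫ u in (0 : ℝ)..Real.pi, Real.exp (r ^ 2 / 2 * Real.sin u ^ 2)
      ≤ Real.pi * Real.exp (r ^ 2 / 2) / r := by
  set a := r ^ 2 / 2 with ha
  have ha0 : 0 < a := by positivity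
  have hexp : HasSum (fun n : ℕ => a ^ n / n.factorial) (Real.exp a) := by
    rw [Real.exp_eq_exp_ℝ]
    exact NormedSpace.expSeries_div_hasSum_exp a
  have hexp' : HasSum (fun n : ℕ => a ^ n / n.factorial * (1 / ((n : ℝ) + 1)))
      ((Real.exp a - 1) / a) := by
    have := ((hasSum_nat_add_iff' 1).2 hexp).div_const a
    simp only [Finset.range_one, Finset.sum_singleton, pow_zero, Nat.factorial_zero,
      Nat.cast_one, div_one] at this
    refine this.congr_fun fun n => ?_
    rw [Nat.factorial_succ]
    push_cast
    field_simp
    ring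
  have hsing : HasSum (fun n : ℕ => if n = 0 then 1 - r / 4 - 1 / (2 * r) else 0)
      (1 - r / 4 - 1 / (2 * r)) := hasSum_ite_eq 0 _
  have hup := (((hexp'.mul_left (r / 4)).add (hexp.mul_right (1 / (2 * r)))).add hsing).mul_left
    Real.pi
  refine (hasSum_le (fun n => ?_) (hasSum_integral_exp_mul_sin_sq ha0.le) hup).trans ?_
  · rw [mul_left_comm]
    refine mul_le_mul_of_nonneg_left ?_ Real.pi_pos.le
    refine (mul_le_mul_of_nonneg_left (wallisMean_le hr n) (by positivity)).trans (le_of_eq ?_)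
    by_cases hn : n = 0
    · subst hn; simp
    · simp only [if_neg hn]; ring
  · rw [mul_div_assoc]
    refine mul_le_mul_of_nonneg_left ?_ Real.pi_pos.le
    have e : r / 4 * ((Real.exp a - 1) / a) + Real.exp a * (1 / (2 * r))
        + (1 - r / 4 - 1 / (2 * r)) = Real.exp a / r - (r - 2) ^ 2 / (4 * r) := by
      rw [show (Real.exp a - 1) / a = 2 * (Real.exp a - 1) / r ^ 2 by
        rw [ha]; field_simp]
      generalize Real.exp a = E
      field_simp
      ring
    have : 0 ≤ (r - 2) ^ 2 / (4 * r) := by positivity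
    linarith

/-! ### Fourier bound for the point probabilities -/

section Fourier

variable {ι : Type*} [DecidableEq ι] {p : ι → ℝ} {S : Finset ι}

theorem integral_exp_neg_int_mul_I (k : ℤ) :
    ∫ t in (-Real.pi)..Real.pi, Complex.exp (-(k : ℂ) * t * Complex.I)
      = if 0 = k then 2 * Real.pi else 0 := by
  split_ifs with h
  · subst h
    simp
    ring
  · have hk : -(k : ℂ) * Complex.I ≠ 0 := by
      simp [Complex.I_ne_zero, Ne.symm h]
    have := integral_exp_mul_complex (a := -Real.pi) (b := Real.pi) hk
    simp only [mul_right_comm _ Complex.I] at this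
    have hper : Complex.exp (-(k : ℂ) * Real.pi * Complex.I)
        = Complex.exp (-(k : ℂ) * (-Real.pi : ℝ) * Complex.I) := by
      rw [Complex.exp_eq_exp_iff_exists_int]
      refine ⟨-k, ?_⟩
      push_cast
      ring
    rw [this, hper, sub_self, zero_div, Complex.ofReal_zero]

/-- Fourier inversion for the point probabilities. -/
theorem two_pi_mul_successProb (k : ℤ) :
    ((2 * Real.pi * successProb p S k : ℝ) : ℂ)
      = ∫ t in (-Real.pi)..Real.pi, Complex.exp (-(k : ℂ) * t * Complex.I)
          * ∏ i ∈ S, ((1 - p i : ℝ) + (p i : ℝ) * Complex.exp (t * Complex.I)) := by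
  induction S using Finset.induction_on generalizing k with
  | empty =>
    simp only [Finset.prod_empty, mul_one, integral_exp_neg_int_mul_I, successProb_empty]
    split_ifs <;> simp
  | insert j S hj ih =>
    have e : ∀ t : ℝ, Complex.exp (-(k : ℂ) * t * Complex.I)
          * ∏ i ∈ insert j S, ((1 - p i : ℝ) + (p i : ℝ) * Complex.exp (t * Complex.I))
        = (1 - p j : ℝ) * (Complex.exp (-(k : ℂ) * t * Complex.I)
          * ∏ i ∈ S, ((1 - p i : ℝ) + (p i : ℝ) * Complex.exp (t * Complex.I)))
          + (p j : ℝ) * (Complex.exp (-((k - 1 : ℤ) : ℂ) * t * Complex.I)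
          * ∏ i ∈ S, ((1 - p i : ℝ) + (p i : ℝ) * Complex.exp (t * Complex.I))) := by
      intro t
      have h1 : Complex.exp (-((k - 1 : ℤ) : ℂ) * t * Complex.I)
          = Complex.exp (-(k : ℂ) * t * Complex.I) * Complex.exp (t * Complex.I) := by
        rw [← Complex.exp_add]
        congr 1
        push_cast
        ring
      rw [Finset.prod_insert hj, h1]
      ring
    simp only [e]
    rw [intervalIntegral.integral_add, intervalIntegral.integral_const_mul,
      intervalIntegral.integral_const_mul, ← ih, ← ih, successProb_insert hj]
    · push_cast
      ring
    · exact Continuous.intervalIntegrable (by fun_prop) _ _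
    · exact Continuous.intervalIntegrable (by fun_prop) _ _

/-- The squared modulus is 1 − 2a(1 − a)(1 − cos t), and 1 + x ≤ eˣ. -/
theorem norm_bernoulli_charFun_le (a t : ℝ) :
    ‖((1 - a : ℝ) : ℂ) + (a : ℝ) * Complex.exp (t * Complex.I)‖
      ≤ Real.exp (-(a * (1 - a)) * (1 - Real.cos t)) := by
  refine le_of_sq_le_sq ?_ (Real.exp_pos _).le
  have e : ‖((1 - a : ℝ) : ℂ) + (a : ℝ) * Complex.exp (t * Complex.I)‖ ^ 2
      = 1 + 2 * (-(a * (1 - a)) * (1 - Real.cos t)) := by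
    rw [Complex.sq_norm, Complex.normSq_apply]
    simp [Complex.exp_ofReal_mul_I_re, Complex.exp_ofReal_mul_I_im]
    linear_combination a ^ 2 * Real.sin_sq_add_cos_sq t
  rw [e, ← Real.exp_nat_mul, add_comm]
  exact_mod_cast Real.add_one_le_exp _

/-- The point probabilities are at most `1 / (2 s)`, where `s` is the standard deviation. -/
theorem successProb_le {s : ℝ} (hs : 0 < s)
    (hsum : s ^ 2 ≤ ∑ i ∈ S, p i * (1 - p i)) (k : ℤ) :
    successProb p S k ≤ 1 / (2 * s) := by
  have hb : ‖((2 * Real.pi * successProb p S k : ℝ) : ℂ)‖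
      ≤ ∫ t in (-Real.pi)..Real.pi, Real.exp (-s ^ 2 * (1 - Real.cos t)) := by
    rw [two_pi_mul_successProb]
    refine intervalIntegral.norm_integral_le_of_norm_le (by linarith [Real.pi_pos]) ?_
      (Continuous.intervalIntegrable (by fun_prop) _ _)
    refine Filter.Eventually.of_forall fun t _ => ?_
    have hk : ‖Complex.exp (-(k : ℂ) * t * Complex.I)‖ = 1 := by
      have := Complex.norm_exp_ofReal_mul_I (-(k : ℝ) * t)
      push_cast at this
      exact this
    rw [norm_mul, hk, one_mul, norm_prod]
    refine (Finset.prod_le_prod (fun _ _ => norm_nonneg _)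
      fun i _ => norm_bernoulli_charFun_le (p i) t).trans ?_
    rw [← Real.exp_sum, ← Finset.sum_mul, Finset.sum_neg_distrib]
    exact Real.exp_le_exp.2 (mul_le_mul_of_nonneg_right (neg_le_neg hsum)
      (by linarith [Real.cos_le_one t]))
  -- Substituting t = 2u − π turns 1 − cos t into 2 − 2 sin² u, which is the integral estimated
  -- above with r = 2s.
  have hI : ∫ t in (-Real.pi)..Real.pi, Real.exp (-s ^ 2 * (1 - Real.cos t))
      = 2 * (Real.exp (-((2 * s) ^ 2 / 2))
        * ∫ u in (0 : ℝ)..Real.pi, Real.exp ((2 * s) ^ 2 / 2 * Real.sin u ^ 2)) := by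
    have := intervalIntegral.smul_integral_comp_mul_sub (E := ℝ) (a := 0) (b := Real.pi)
      (fun t => Real.exp (-s ^ 2 * (1 - Real.cos t))) 2 Real.pi
    rw [show 2 * 0 - Real.pi = -Real.pi by ring, show 2 * Real.pi - Real.pi = Real.pi by ring]
      at this
    rw [← this, smul_eq_mul, ← intervalIntegral.integral_const_mul (Real.exp _)]
    refine congrArg ((2 : ℝ) * ·) (intervalIntegral.integral_congr fun u _ => ?_)
    rw [← Real.exp_add, Real.cos_sub_pi, Real.cos_two_mul, Real.cos_sq']
    congr 1
    ring
  have hle := mul_le_mul_of_nonneg_left (integral_exp_mul_sin_sq_le (show 0 < 2 * s by positivity))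
    (Real.exp_pos (-((2 * s) ^ 2 / 2))).le
  rw [Complex.norm_real, Real.norm_eq_abs, hI] at hb
  have e : Real.exp (-((2 * s) ^ 2 / 2)) * (Real.pi * Real.exp ((2 * s) ^ 2 / 2) / (2 * s))
      = Real.pi * (1 / (2 * s)) := by
    rw [Real.exp_neg]
    field_simp
  rw [e] at hle
  have := (le_abs_self _).trans hb
  refine le_of_mul_le_mul_left ?_ (show 0 < 2 * Real.pi by positivity)
  linarith

end Fourier

/-! ### Solution of the Stein equation -/

section Stein

variable {μ v : ℝ} {κ : ℤ}

theorem measureReal_eq_tsum (ν : Measure ℤ) [IsFiniteMeasure ν] (A : Set ℤ) :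
    ν.real A = ∑' k, A.indicator (fun k => ν.real {k}) k := by
  have hA : MeasurableSet A := Set.to_countable A |>.measurableSet
  have hi : Integrable (A.indicator fun _ => (1 : ℝ)) ν := (integrable_const 1).indicator hA
  have := integral_countable hi
  rw [integral_indicator_const _ hA, smul_eq_mul, mul_one] at this
  rw [this]
  refine tsum_congr fun k => ?_
  by_cases hk : k ∈ A <;> simp [hk]

theorem summable_measureReal_indicator (ν : Measure ℤ) [IsFiniteMeasure ν] (A : Set ℤ) :
    Summable (A.indicator fun k => ν.real {k}) := by
  have h := (integrable_const (μ := ν) (1 : ℝ))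
  rw [← Measure.sum_smul_dirac ν, integrable_sum_dirac_iff (by simp)] at h
  refine Summable.indicator (h.congr fun k => ?_) A
  simp [measureReal_def]

/-- Comparison of the measures of a set and of its translate by one. -/
theorem mul_measureReal_le_of_shift {ν : Measure ℤ} [IsFiniteMeasure ν] {A B : Set ℤ} {a b : ℝ}
    (hAB : ∀ k, k + 1 ∈ A ↔ k ∈ B)
    (h : ∀ k ∈ B, a * ν.real {k + 1} ≤ b * ν.real {k}) : a * ν.real A ≤ b * ν.real B := by
  rw [measureReal_eq_tsum ν A, measureReal_eq_tsum ν B, ← tsum_mul_left, ← tsum_mul_left,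
    ← (Equiv.addRight (1 : ℤ)).tsum_eq]
  have hs : Summable fun k => a * A.indicator (fun k => ν.real {k}) k :=
    (summable_measureReal_indicator ν A).mul_left a
  refine Summable.tsum_le_tsum (fun k => ?_) ((Equiv.addRight (1 : ℤ)).summable_iff.2 hs)
    ((summable_measureReal_indicator ν B).mul_left b)
  rw [Equiv.coe_addRight]
  by_cases hk : k ∈ B
  · rw [Set.indicator_of_mem hk, Set.indicator_of_mem ((hAB k).2 hk)]
    exact h k hk
  · rw [Set.indicator_of_notMem hk, Set.indicator_of_notMem (mt (hAB k).1 hk), mul_zero, mul_zero]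

theorem mul_measureReal_le_of_shift' {ν : Measure ℤ} [IsFiniteMeasure ν] {A B : Set ℤ} {a b : ℝ}
    (hAB : ∀ k, k + 1 ∈ A ↔ k ∈ B)
    (h : ∀ k ∈ B, b * ν.real {k} ≤ a * ν.real {k + 1}) : b * ν.real B ≤ a * ν.real A := by
  have := mul_measureReal_le_of_shift (ν := ν) (a := -a) (b := -b) hAB fun k hk => by
    linarith [h k hk]
  linarith

/-- The pointwise estimate behind the bound for the solutions of the Stein equation: `F`, `x₀`,
`G` are the probabilities below, at and above a point, and `L`, `x`, `R` their parts in a set. -/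
theorem stein_increment_le {F x₀ G L x R b d v : ℝ} (hx₀ : 0 < x₀) (hv : 0 < v) (hb : v ≤ b)
    (hd : v ≤ d) (hF : 0 ≤ F) (hG : 0 ≤ G) (hL : 0 ≤ L) (hR : 0 ≤ R) (hx : x ≤ x₀)
    (htot : F + x₀ + G = 1) (h1 : d * G ≤ b * (x₀ + G)) (h2 : b * F ≤ d * (F + x₀)) :
    (L + x - (F + x₀) * (L + x + R)) / (b * x₀) - (L - F * (L + x + R)) / (d * x₀) ≤ 1 / v := by
  have hb0 : 0 < b := hv.trans_le hb
  have hd0 : 0 < d := hv.trans_le hd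
  -- The expression is linear in `L`, `x`, `R`. By `h1` and `h2` the coefficients of `L` and `R` are
  -- nonpositive, so the extreme set is the point itself.
  have e : (L + x - (F + x₀) * (L + x + R)) / (b * x₀) - (L - F * (L + x + R)) / (d * x₀)
      = L * ((d * G - b * (x₀ + G)) / (b * d * x₀)) + R * ((b * F - d * (F + x₀)) / (b * d * x₀))
        + x / x₀ * (G / b + F / d) := by
    obtain rfl : G = 1 - F - x₀ := by linarith
    field_simp
    ring
  have t1 : L * ((d * G - b * (x₀ + G)) / (b * d * x₀)) ≤ 0 :=
    mul_nonpos_of_nonneg_of_nonpos hL (div_nonpos_of_nonpos_of_nonneg (by linarith) (by positivity))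
  have t2 : R * ((b * F - d * (F + x₀)) / (b * d * x₀)) ≤ 0 :=
    mul_nonpos_of_nonneg_of_nonpos hR (div_nonpos_of_nonpos_of_nonneg (by linarith) (by positivity))
  have t3 : x / x₀ * (G / b + F / d) ≤ G / b + F / d :=
    mul_le_of_le_one_left (by positivity) ((div_le_one hx₀).2 hx)
  have t4 : G / b + F / d ≤ G / v + F / v := by gcongr
  have t5 : G / v + F / v ≤ 1 / v := by
    rw [← add_div]
    exact div_le_div_of_nonneg_right (by linarith) hv.le
  linarith

/-- To the left of κ one has i ≤ κ − 1 < μ, hence v + μ − i > v: the bound κ < μ + 1 prevents an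
upward jump at κ. In `death_mono` the bound μ ≤ κ plays this role. -/
theorem birth_anti (hκ : κ < μ + 1) {i j : ℤ} (h : i ≤ j) : birth μ v κ j ≤ birth μ v κ i := by
  unfold birth
  have hij : (i : ℝ) ≤ j := by exact_mod_cast h
  split_ifs with h1 h2 h2
  · exact le_rfl
  · have : (i : ℝ) + 1 ≤ κ := by exact_mod_cast (by omega : i + 1 ≤ κ)
    linarith
  · omega
  · linarith

theorem death_mono (hκ : μ ≤ κ) {i j : ℤ} (h : i ≤ j) : death μ v κ i ≤ death μ v κ j := by
  unfold death
  have hij : (i : ℝ) ≤ j := by exact_mod_cast h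
  split_ifs with h1 h2 h2
  · linarith
  · omega
  · have : (κ : ℝ) ≤ j := by exact_mod_cast h2
    linarith
  · exact le_rfl

theorem le_birth (hκ : κ < μ + 1) (i : ℤ) : v ≤ birth μ v κ i :=
  calc v = birth μ v κ (max i κ) := by simp [birth]
    _ ≤ _ := birth_anti hκ (le_max_left _ _)

theorem le_death (hκ : μ ≤ κ) (i : ℤ) : v ≤ death μ v κ i :=
  calc v = death μ v κ (min i (κ - 1)) := by simp [death]
    _ ≤ _ := death_mono hκ (min_le_left _ _)

/-- The Stein equation for `Ψ(μ, v)` and the indicator of a set has a solution whose increments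
are bounded by `1 / v`. -/
theorem exists_stein_solution (hv : 0 < v) (hκ : μ ≤ κ) (hκ' : κ < μ + 1) (A : Set ℤ) :
    ∃ f : ℤ → ℝ, (∀ i, steinOp μ v κ f i = A.indicator 1 i - (psiKappa μ v κ).real A) ∧
      ∀ i, |f (i + 1) - f i| ≤ 1 / v := by
  have h1 : μ - v ≤ κ := by linarith
  have h2 : κ < μ + v + 1 := by linarith
  have hprob := isProbabilityMeasure_psiKappa hv h1 h2
  set ν := psiKappa μ v κ with hν
  have hbal : ∀ i, birth μ v κ i * ν.real {i} = death μ v κ (i + 1) * ν.real {i + 1} := by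
    intro i
    rw [psiKappa_singleton hv h1 h2, psiKappa_singleton hv h1 h2, ← mul_div_assoc,
      ← mul_div_assoc, balance hv h1 h2]
  have hb : ∀ i, v ≤ birth μ v κ i := le_birth hκ'
  have hd : ∀ i, v ≤ death μ v κ i := le_death hκ
  have hb0 : ∀ i, 0 < birth μ v κ i := fun i => hv.trans_le (hb i)
  have hd0 : ∀ i, 0 < death μ v κ i := fun i => hv.trans_le (hd i)
  have hκpos : 0 < ν.real {κ} := by
    rw [psiKappa_singleton hv h1 h2, psiWeight_self]
    exact one_div_pos.2 (tsum_psiWeight_pos hv h1 h2)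
  have hpos : ∀ i, 0 < ν.real {i} := by
    intro i
    induction i using Int.inductionOn' (b := κ) with
    | zero => exact hκpos
    | succ k _ ih =>
      have := mul_pos (hb0 k) ih
      rw [hbal] at this
      exact pos_of_mul_pos_right this (hd0 _).le
    | pred k _ ih =>
      have e := hbal (k - 1)
      rw [sub_add_cancel] at e
      have := mul_pos (hd0 k) ih
      rw [← e] at this
      exact pos_of_mul_pos_right this (hb0 _).le
  have hmeas : ∀ s : Set ℤ, MeasurableSet s := fun s => (Set.to_countable s).measurableSet
  have hunion : ∀ s t : Set ℤ, Disjoint s t → ν.real (s ∪ t) = ν.real s + ν.real t :=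
    fun s t hst => measureReal_union hst (hmeas t)
  have hIio : ∀ B : Set ℤ, ∀ i : ℤ,
      ν.real (B ∩ Set.Iio (i + 1)) = ν.real (B ∩ Set.Iio i) + ν.real (B ∩ {i}) := by
    intro B i
    rw [← hunion]
    · congr 1
      ext k
      simp only [Set.mem_inter_iff, Set.mem_Iio, Set.mem_union, Set.mem_singleton_iff]
      rw [← and_or_left]
      exact and_congr_right fun _ => by omega
    · exact Set.disjoint_left.2 fun k hk hk' => by
        have h3 := hk.2
        have h4 := hk'.2
        simp only [Set.mem_Iio, Set.mem_singleton_iff] at h3 h4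
        omega
  have hsplit : ∀ B : Set ℤ, ∀ i : ℤ,
      ν.real B = ν.real (B ∩ Set.Iio i) + ν.real (B ∩ {i}) + ν.real (B ∩ Set.Ioi i) := by
    intro B i
    rw [← hIio, ← hunion]
    · congr 1
      ext k
      simp only [Set.mem_inter_iff, Set.mem_Iio, Set.mem_union, Set.mem_Ioi]
      rw [← and_or_left]
      exact ⟨fun h => ⟨h, by omega⟩, fun h => h.1⟩
    · exact Set.disjoint_left.2 fun k hk hk' => by
        have h3 := hk.2
        have h4 := hk'.2
        simp only [Set.mem_Iio, Set.mem_Ioi] at h3 h4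
        omega
  have hincr : ∀ B : Set ℤ, ∀ i : ℤ,
      (ν.real (B ∩ Set.Iio (i + 1)) - ν.real (Set.Iio (i + 1)) * ν.real B)
          / (birth μ v κ i * ν.real {i})
        - (ν.real (B ∩ Set.Iio i) - ν.real (Set.Iio i) * ν.real B)
          / (death μ v κ i * ν.real {i}) ≤ 1 / v := by
    intro B i
    have u1 := hIio Set.univ i
    have u2 := hsplit Set.univ i
    simp only [Set.univ_inter, probReal_univ] at u1 u2
    have u3 := hunion {i} (Set.Ioi i) (by simp)
    have hset : {i} ∪ Set.Ioi i = Set.Ici i := by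
      rw [Set.singleton_union, Set.Ioi_insert]
    have u4 : ν.real (Set.Iic i) = ν.real (Set.Iio i) + ν.real {i} := by
      rw [← u1]
      congr 1
      ext k
      simp only [Set.mem_Iic, Set.mem_Iio]
      omega
    rw [hset] at u3
    rw [hIio, u1, hsplit B i]
    refine stein_increment_le (hpos i) hv (hb i) (hd i) measureReal_nonneg measureReal_nonneg
      measureReal_nonneg measureReal_nonneg (measureReal_mono Set.inter_subset_right) u2.symm ?_ ?_
    -- For k ≥ i, balance and monotonicity of the rates give death(i) ν{k+1} ≤ birth(i) ν{k};
    -- summing over k compares the two tails. The lower tails are treated in the same way.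
    · rw [← u3]
      refine mul_measureReal_le_of_shift (fun k => ?_) fun k hk => ?_
      · simp only [Set.mem_Ioi, Set.mem_Ici]; omega
      · have hk : i ≤ k := hk
        calc death μ v κ i * ν.real {k + 1}
            ≤ death μ v κ (k + 1) * ν.real {k + 1} :=
              mul_le_mul_of_nonneg_right (death_mono hκ (by omega)) measureReal_nonneg
          _ = birth μ v κ k * ν.real {k} := (hbal k).symm
          _ ≤ birth μ v κ i * ν.real {k} :=
              mul_le_mul_of_nonneg_right (birth_anti hκ' hk) measureReal_nonneg
    · rw [← u4]
      refine mul_measureReal_le_of_shift' (fun k => ?_) fun k hk => ?_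
      · simp only [Set.mem_Iio, Set.mem_Iic]; omega
      · have hk : k < i := hk
        calc birth μ v κ i * ν.real {k} ≤ birth μ v κ k * ν.real {k} :=
              mul_le_mul_of_nonneg_right (birth_anti hκ' hk.le) measureReal_nonneg
          _ = death μ v κ (k + 1) * ν.real {k + 1} := hbal k
          _ ≤ death μ v κ i * ν.real {k + 1} :=
              mul_le_mul_of_nonneg_right (death_mono hκ (by omega)) measureReal_nonneg
  -- Multiplied by ν{i}, the Stein equation telescopes by balance: death(i) ν{i} f(i) increases by
  -- ν{i}(1_A(i) − ν(A)) from i to i + 1. Summing from −∞ gives this f.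
  refine ⟨fun i => (ν.real (A ∩ Set.Iio i) - ν.real (Set.Iio i) * ν.real A)
    / (death μ v κ i * ν.real {i}), fun i => ?_, fun i => ?_⟩
  · have hne := (hpos i).ne'
    have hdne := (hd0 i).ne'
    have hbne := (hb0 i).ne'
    have u1 := hIio Set.univ i
    simp only [Set.univ_inter] at u1
    have hA : ν.real (A ∩ {i}) = A.indicator 1 i * ν.real {i} := by
      by_cases hi : i ∈ A
      · rw [Set.inter_eq_right.2 (Set.singleton_subset_iff.2 hi)]; simp [hi]
      · rw [Set.inter_singleton_eq_empty.2 hi]; simp [hi]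
    rw [steinOp_eq, ← hbal, hIio, u1, hA]
    field_simp
    ring
  · simp only [← hbal]
    refine abs_le.2 ⟨?_, hincr A i⟩
    -- The solution for the complement is −f, so the upper bound for all sets yields the lower
    -- bound.
    have hc := hincr Aᶜ i
    have hcompl : ∀ j, ν.real (Aᶜ ∩ Set.Iio j) - ν.real (Set.Iio j) * ν.real Aᶜ
        = -(ν.real (A ∩ Set.Iio j) - ν.real (Set.Iio j) * ν.real A) := by
      intro j
      have e1 := hunion (A ∩ Set.Iio j) (Aᶜ ∩ Set.Iio j)
        (Set.disjoint_left.2 fun k hk hk' => hk'.1 hk.1)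
      rw [← Set.union_inter_distrib_right, Set.union_compl_self, Set.univ_inter] at e1
      rw [probReal_compl_eq_one_sub (hmeas A)]
      linear_combination -e1
    rw [hcompl, hcompl, neg_div, neg_div] at hc
    linarith

end Stein

/-! ### The law of the sum -/

section Law

/-- The law of a sum of independent indicators. -/
theorem measureReal_sum_indicators {Ω ι : Type*} [DecidableEq ι] [MeasurableSpace Ω]
    {P : Measure Ω} [IsProbabilityMeasure P] {p : ι → ℝ} {I : ι → Ω → ℤ}
    (hmeas : ∀ i, Measurable (I i)) (hindep : iIndepFun I P)
    (hone : ∀ i, P.real {ω | I i ω = 1} = p i) (hzero : ∀ i, P.real {ω | I i ω = 0} = 1 - p i)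
    (S : Finset ι) (A : Set ℤ) :
    P.real {ω | ∑ i ∈ S, I i ω ∈ A} = successExp p S (A.indicator 1) := by
  induction S using Finset.induction_on generalizing A with
  | empty =>
    rw [successExp_empty]
    by_cases h : (0 : ℤ) ∈ A <;> simp [h]
  | insert j S hj ih =>
    have hA : ∀ B : Set ℤ, MeasurableSet B := fun B => (Set.to_countable B).measurableSet
    have hmS : Measurable fun ω => ∑ i ∈ S, I i ω :=
      Finset.measurable_sum S fun i _ => hmeas i
    have hind : IndepFun (fun ω => ∑ i ∈ S, I i ω) (I j) P := by
      have := hindep.indepFun_finsetSum_of_notMem hmeas hj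
      rwa [show (∑ i ∈ S, I i) = fun ω => ∑ i ∈ S, I i ω by ext; simp] at this
    have hmul : ∀ B C : Set ℤ, P.real ({ω | ∑ i ∈ S, I i ω ∈ B} ∩ {ω | I j ω ∈ C})
        = P.real {ω | ∑ i ∈ S, I i ω ∈ B} * P.real {ω | I j ω ∈ C} := by
      intro B C
      have := hind.measure_inter_preimage_eq_mul B C (hA B) (hA C)
      simp only [measureReal_def, ← ENNReal.toReal_mul]
      exact congrArg ENNReal.toReal this
    have h0 : MeasurableSet {ω | I j ω = 0} := hmeas j (hA {0})
    have h1 : MeasurableSet {ω | I j ω = 1} := hmeas j (hA {1})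
    have hdisj : Disjoint {ω | I j ω = 0} {ω | I j ω = 1} :=
      Set.disjoint_left.2 fun ω (ha : I j ω = 0) (hb : I j ω = 1) => by omega
    -- The variables are only integer-valued a priori; the two given probabilities add up to 1, so
    -- the values are 0 or 1 almost surely.
    have hfull : P ({ω | I j ω = 0} ∪ {ω | I j ω = 1})ᶜ = 0 := by
      have : P.real ({ω | I j ω = 0} ∪ {ω | I j ω = 1})ᶜ = 0 := by
        rw [probReal_compl_eq_one_sub (h0.union h1), measureReal_union hdisj h1, hzero, hone]
        ring
      exact (measureReal_eq_zero_iff).1 this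
    have hae : ({ω | ∑ i ∈ insert j S, I i ω ∈ A} : Set Ω) =ᵐ[P]
        (({ω | ∑ i ∈ S, I i ω ∈ A} ∩ {ω | I j ω ∈ ({0} : Set ℤ)}) ∪
          ({ω | ∑ i ∈ S, I i ω ∈ {k | k + 1 ∈ A}} ∩ {ω | I j ω ∈ ({1} : Set ℤ)}) : Set Ω) := by
      have : ∀ᵐ ω ∂P, I j ω = 0 ∨ I j ω = 1 := hfull
      filter_upwards [this] with ω hω
      refine propext ?_
      change (∑ i ∈ insert j S, I i ω ∈ A) ↔ (∑ i ∈ S, I i ω ∈ A ∧ I j ω = 0)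
        ∨ (∑ i ∈ S, I i ω + 1 ∈ A ∧ I j ω = 1)
      rw [Finset.sum_insert hj]
      rcases hω with h | h
      · simp [h]
      · simp [h, add_comm]
    rw [measureReal_congr hae, measureReal_union, hmul, hmul, ih, ih, successExp_insert hj]
    · have e0 : P.real {ω | I j ω ∈ ({0} : Set ℤ)} = 1 - p j := hzero j
      have e1 : P.real {ω | I j ω ∈ ({1} : Set ℤ)} = p j := hone j
      rw [e0, e1, mul_comm, mul_comm (successExp _ _ _) (p j)]
      rfl
    · exact hdisj.mono Set.inter_subset_right Set.inter_subset_right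
    · exact (hmS (hA _)).inter (hmeas j (hA _))

end Law

/-! ### Estimate of the expected Stein operator -/

section Comparison

variable {ι : Type*} [Fintype ι] [DecidableEq ι] {p : ι → ℝ} {μ v : ℝ} {κ : ℤ}

/-- The coefficients are v + (μ − k)⁺ and v + (k − μ)⁺; then x⁺ = (|x| + x)/2. -/
theorem steinOp_eq_symm (h : μ ≤ κ) (h' : κ < μ + 1) (f : ℤ → ℝ) (k : ℤ) :
    steinOp μ v κ f k = v * (f (k + 1) - f k) - (k - μ) * (1 / 2 * (f k + f (k + 1)))
      + 1 / 2 * (|(k : ℝ) - μ| * (f (k + 1) - f k)) := by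
  unfold steinOp
  split_ifs with hk
  · have : (κ : ℝ) ≤ k := by exact_mod_cast hk
    rw [abs_of_nonneg (by linarith)]
    ring
  · have : (k : ℝ) + 1 ≤ κ := by exact_mod_cast (by omega : k + 1 ≤ κ)
    rw [abs_of_nonpos (by linarith)]
    ring

/-- Write |k − μ| as k − μ times a sign that jumps by 2 at κ − 1; the first order identity leaves 2
∑ p_i(1 − p_i) P(W_i = κ − 1). -/
theorem successExp_abs_centered_le {M : ℝ} (h0 : ∀ i, 0 ≤ p i) (h1 : ∀ i, p i ≤ 1)
    (hμ : μ = ∑ i, p i) (hv : v = ∑ i, p i * (1 - p i)) (h : μ ≤ κ) (h' : κ < μ + 1)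
    (hM : ∀ i k, successProb p (Finset.univ.erase i) k ≤ M) :
    successExp p Finset.univ (fun k => |(k : ℝ) - μ|) ≤ 2 * v * M := by
  have e : (fun k : ℤ => |(k : ℝ) - μ|)
      = fun k : ℤ => (k - ∑ i, p i) * if κ ≤ k then (1 : ℝ) else -1 := by
    funext k
    rw [← hμ]
    split_ifs with hk
    · have : (κ : ℝ) ≤ k := by exact_mod_cast hk
      rw [abs_of_nonneg (by linarith), mul_one]
    · have : (k : ℝ) + 1 ≤ κ := by exact_mod_cast (by omega : k + 1 ≤ κ)
      rw [abs_of_nonpos (by linarith)]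
      ring
  have hstep : (fun k : ℤ => (if κ ≤ k + 1 then (1 : ℝ) else -1) - if κ ≤ k then 1 else -1)
      = fun k => 2 * if k = κ - 1 then 1 else 0 := by
    funext k
    split_ifs <;> first | omega | norm_num
  rw [e, successExp_centered (fun k => if κ ≤ k then (1 : ℝ) else -1), hstep, hv, Finset.mul_sum,
    Finset.sum_mul]
  refine Finset.sum_le_sum fun i _ => ?_
  rw [successExp_const_mul]
  have := mul_le_mul_of_nonneg_left (hM i (κ - 1))
    (mul_nonneg (h0 i) (sub_nonneg.2 (h1 i)))
  unfold successProb at this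
  linarith

theorem abs_successExp_steinOp_le {M : ℝ} (h0 : ∀ i, 0 ≤ p i) (h1 : ∀ i, p i ≤ 1)
    (hμ : μ = ∑ i, p i) (hv : v = ∑ i, p i * (1 - p i)) (hv0 : 0 < v) (h : μ ≤ κ)
    (h' : κ < μ + 1) (hM : ∀ i k, successProb p (Finset.univ.erase i) k ≤ M) {f : ℤ → ℝ}
    (hf : ∀ k, |f (k + 1) - f k| ≤ 1 / v) :
    |successExp p Finset.univ (steinOp μ v κ f)| ≤ 2 * M := by
  set D : ℤ → ℝ := fun k => f (k + 1) - f k with hD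
  have hsecond : |successExp p Finset.univ fun k => |(k : ℝ) - μ| * D k| ≤ 2 * M := by
    refine (abs_successExp_le h0 h1 (h := fun k => 1 / v * |(k : ℝ) - μ|) fun k => ?_).trans ?_
    · rw [abs_mul, abs_abs, mul_comm]
      exact mul_le_mul_of_nonneg_right (hf k) (abs_nonneg _)
    · rw [successExp_const_mul]
      have := mul_le_mul_of_nonneg_left (successExp_abs_centered_le h0 h1 hμ hv h h' hM)
        (one_div_pos.2 hv0).le
      rwa [show 1 / v * (2 * v * M) = 2 * M by field_simp] at this
  -- Conditioning on I_i weights D(k) and D(k+1) by 1 − p_i and p_i, while the centered term weights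
  -- both by 1/2; the difference is (p_i − 1/2)(D(k+1) − D(k)).
  have hfirst : v * successExp p Finset.univ D
        - successExp p Finset.univ (fun k => (k - μ) * (1 / 2 * (f k + f (k + 1))))
      = ∑ i, p i * (1 - p i) * ((p i - 1 / 2)
          * successExp p (Finset.univ.erase i) fun k => D (k + 1) - D k) := by
    rw [hμ, successExp_centered (fun k => 1 / 2 * (f k + f (k + 1))), hv, Finset.sum_mul,
      ← Finset.sum_sub_distrib]
    refine Finset.sum_congr rfl fun i _ => ?_
    have e1 : successExp p Finset.univ D = (1 - p i) * successExp p (Finset.univ.erase i) D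
        + p i * successExp p (Finset.univ.erase i) fun k => D (k + 1) := by
      rw [← successExp_insert (by simp), Finset.insert_erase (Finset.mem_univ i)]
    have e2 : (fun k => 1 / 2 * (f (k + 1) + f (k + 1 + 1)) - 1 / 2 * (f k + f (k + 1)))
        = fun k => 1 / 2 * (D k + D (k + 1)) := by
      funext k; simp only [hD]; ring
    rw [e1, e2, successExp_const_mul, successExp_add, successExp_sub (fun k => D (k + 1)) D]
    ring
  have hfirst_le : |v * successExp p Finset.univ D
      - successExp p Finset.univ (fun k => (k - μ) * (1 / 2 * (f k + f (k + 1))))| ≤ M := by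
    rw [hfirst]
    refine (Finset.abs_sum_le_sum_abs _ _).trans ?_
    have : ∀ i ∈ Finset.univ, |p i * (1 - p i) * ((p i - 1 / 2)
          * successExp p (Finset.univ.erase i) fun k => D (k + 1) - D k)|
        ≤ p i * (1 - p i) * (1 / v * M) := by
      intro i _
      have hw := mul_nonneg (h0 i) (sub_nonneg.2 (h1 i))
      rw [abs_mul, abs_of_nonneg hw, abs_mul]
      refine mul_le_mul_of_nonneg_left ?_ hw
      have hhalf : |p i - 1 / 2| ≤ 1 / 2 := abs_le.2 ⟨by linarith [h0 i], by linarith [h1 i]⟩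
      refine (mul_le_mul hhalf (abs_successExp_diff_le h0 h1 hf (hM i)) (abs_nonneg _)
        (by norm_num)).trans (le_of_eq ?_)
      ring
    refine (Finset.sum_le_sum this).trans (le_of_eq ?_)
    rw [← Finset.sum_mul, ← hv]
    field_simp
  have hsplit : successExp p Finset.univ (steinOp μ v κ f) = v * successExp p Finset.univ D
      - successExp p Finset.univ (fun k => (k - μ) * (1 / 2 * (f k + f (k + 1))))
      + 1 / 2 * successExp p Finset.univ fun k => |(k : ℝ) - μ| * D k := by
    rw [← successExp_const_mul, ← successExp_const_mul, ← successExp_sub, ← successExp_add]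
    exact congrArg _ (funext fun k => steinOp_eq_symm h h' f k)
  rw [hsplit]
  refine (abs_add_le _ _).trans ?_
  rw [abs_mul, abs_of_pos (show (0 : ℝ) < 1 / 2 by norm_num)]
  linarith

end Comparison

end DiscreteNormal

/-! ### The total variation bound -/

theorem corollary4p3 {Ω : Type*} [MeasurableSpace Ω] (P : Measure Ω) [IsProbabilityMeasure P]
    (n : ℕ) (p : Fin n → ℝ) (I : Fin n → Ω → ℤ)
    (hmeas : ∀ i, Measurable (I i))
    (hindep : iIndepFun I P)
    (hone : ∀ i, P.real {ω | I i ω = 1} = p i)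
    (hzero : ∀ i, P.real {ω | I i ω = 0} = 1 - p i)
    (μ σ ϑ : ℝ)
    (hμ : μ = ∑ i, p i)
    (hσ : σ ^ 2 = ∑ i, p i * (1 - p i))
    (hϑ : ϑ ^ 2 = σ ^ 2 - ⨆ i, p i * (1 - p i))
    (hϑpos : 0 < ϑ) :
    DiscreteNormal.dTV (P.map fun ω => ∑ i, I i ω) (DiscreteNormal.psi μ (σ ^ 2)) ≤ 1 / ϑ := by
  have h0 : ∀ i, 0 ≤ p i := fun i => hone i ▸ measureReal_nonneg
  have h1 : ∀ i, p i ≤ 1 := fun i => sub_nonneg.1 (hzero i ▸ measureReal_nonneg)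
  -- This also covers n = 0, where the real supremum has the default value 0.
  have hsup : 0 ≤ ⨆ i, p i * (1 - p i) :=
    Real.iSup_nonneg fun i => mul_nonneg (h0 i) (sub_nonneg.2 (h1 i))
  have hv : 0 < σ ^ 2 := by linarith [pow_pos hϑpos 2]
  -- Removing one indicator lowers the variance by at most the maximum, so at least ϑ² remains.
  have hM : ∀ i k, DiscreteNormal.successProb p (Finset.univ.erase i) k ≤ 1 / (2 * ϑ) := by
    intro i k
    refine DiscreteNormal.successProb_le hϑpos ?_ k
    have := Finset.add_sum_erase Finset.univ (fun i => p i * (1 - p i)) (Finset.mem_univ i)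
    have hi : p i * (1 - p i) ≤ ⨆ i, p i * (1 - p i) :=
      le_ciSup (f := fun i => p i * (1 - p i)) (Set.finite_range _).bddAbove i
    linarith
  refine ciSup_le fun A => ?_
  obtain ⟨f, hf, hfd⟩ := DiscreteNormal.exists_stein_solution hv (Int.le_ceil μ)
    (Int.ceil_lt_add_one μ) A
  have hA : MeasurableSet A := (Set.to_countable A).measurableSet
  have hlaw : (P.map fun ω => ∑ i, I i ω).real A
      = DiscreteNormal.successExp p Finset.univ (A.indicator 1) := by
    rw [map_measureReal_apply (Finset.measurable_sum _ fun i _ => hmeas i) hA]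
    exact DiscreteNormal.measureReal_sum_indicators hmeas hindep hone hzero Finset.univ A
  have hE : DiscreteNormal.successExp p Finset.univ
        (DiscreteNormal.steinOp μ (σ ^ 2) ⌈μ⌉ f)
      = (P.map fun ω => ∑ i, I i ω).real A - (DiscreteNormal.psi μ (σ ^ 2)).real A := by
    rw [funext hf, DiscreteNormal.successExp_sub, DiscreteNormal.successExp_const, hlaw]
    rfl
  rw [← hE]
  refine (DiscreteNormal.abs_successExp_steinOp_le h0 h1 hμ hσ hv (Int.le_ceil μ)
    (Int.ceil_lt_add_one μ) hM hfd).trans (le_of_eq ?_)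
  field_simp
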